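/- A radio labelling of a finite connected graph $G$ is a map $f:V(G)\to\{0,1,2,\dots\}$ with $|f(u)-f(v)|\ge \operatorname{diam}(G)+1-d(u,v)$ for all distinct vertices $u,v$; its span is $\max_{u,v}|f(u)-f(v)|$, and the radio number $\operatorname{rn}(G)$ is the minimum span of a radio labelling of $G$. For integers $m\ge 2$, $h\ge 2$ and $z\in\{1,2\}$, let $L^z_{m,h}$ be the level-wise regular tree of height $h$ with $z$ central vertices (a single vertex $r$ if $z=1$, two adjacent vertices $r_1,r_2$ if $z=2$; the level of a vertex is its distance to the nearest central vertex) in which the central vertices have degree $2$, every vertex at level $1$ has $m$ children (that is, degree $m+1$), every vertex at a level $i$ with $2\le i\le h-1$ has degree $2$, and the vertices at level $h$ are the leaves. Then $$ \operatorname{rn}(L^z_{m,h})=\begin{cases}2mh(h-2)+3m+4h-1, & z=1,\\ 2mh(h-2)+4m+6h-3, & z=2.\end{cases} $$ -/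

import Mathlib

/-- A radio labelling of a graph `G`: a map `f : V → {0, 1, 2, …}` such that
`|f u - f v| ≥ diam G + 1 - d(u, v)` for all distinct vertices `u`, `v`. -/
def IsRadioLabelling {V : Type*} (G : SimpleGraph V) (f : V → ℕ) : Prop :=
  ∀ u v : V, u ≠ v → (G.diam : ℤ) + 1 - (G.dist u v : ℤ) ≤ |(f u : ℤ) - (f v : ℤ)|

/-- `k` is the span of `f`, that is, `k = max {|f u - f v| : u, v ∈ V}`. -/
def HasSpan {V : Type*} (f : V → ℕ) (k : ℕ) : Prop :=
  IsGreatest {x : ℕ | ∃ u v : V, (x : ℤ) = |(f u : ℤ) - (f v : ℤ)|} k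

/-- The radio number of a (finite connected) graph: the minimum span of its radio labellings. -/
noncomputable def radioNumber {V : Type*} (G : SimpleGraph V) : ℕ :=
  sInf {k : ℕ | ∃ f : V → ℕ, IsRadioLabelling G f ∧ HasSpan f k}

/-- The number of children of a vertex at level `i < h` in the level-wise regular tree with `z`
central vertices in which the vertices at level `i` have degree `d i`: a central vertex
(level `0`) is adjacent to the `z - 1` other central vertices, and a vertex at level `i ≥ 1` is
adjacent to its parent; all the other neighbours are children. -/
def numChildren (z : ℕ) (d : ℕ → ℕ) (i : ℕ) : ℕ :=
  if i = 0 then d 0 - (z - 1) else d i - 1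

/-- The vertices of the level-wise regular tree of height `h` with `z ∈ {1, 2}` central vertices
and degrees `d 0, …, d (h - 1)`. The vertex `(r, [c₀, …, c_{i-1}])` is the vertex at level `i`
reached from the central vertex `r` by going to child number `c₀`, then to child number `c₁` of
that vertex, and so on; the children of a vertex at level `j` are numbered from `0` to
`numChildren z d j - 1`, and the vertices at level `h` have no children. -/
def LevelwiseVertex (z h : ℕ) (d : ℕ → ℕ) : Type :=
  {p : Fin z × List ℕ //
    p.2.length ≤ h ∧ ∀ (j : ℕ) (hj : j < p.2.length), p.2[j] < numChildren z d j}

/-- `v` is a child of `u`. -/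
def IsChild {z h : ℕ} {d : ℕ → ℕ} (u v : LevelwiseVertex z h d) : Prop :=
  v.1.1 = u.1.1 ∧ ∃ c : ℕ, v.1.2 = u.1.2 ++ [c]

/-- The level-wise regular tree `T^z_{d 0, …, d (h-1)}`, `z ∈ {1, 2}`: two vertices are adjacent
when one is a child of the other or when they are the two distinct central vertices. -/
def levelwiseTree (z h : ℕ) (d : ℕ → ℕ) : SimpleGraph (LevelwiseVertex z h d) where
  Adj u v := IsChild u v ∨ IsChild v u ∨ (u ≠ v ∧ u.1.2 = [] ∧ v.1.2 = [])
  symm := by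
    constructor
    rintro u v (h | h | ⟨h1, h2, h3⟩)
    · exact Or.inr (Or.inl h)
    · exact Or.inl h
    · exact Or.inr (Or.inr ⟨h1.symm, h3, h2⟩)
  loopless := by
    constructor
    rintro u (⟨-, c, hc⟩ | ⟨-, c, hc⟩ | ⟨h1, -, -⟩)
    · simp at hc
    · simp at hc
    · exact h1 rfl

/-- The degrees of the trees `L^z_{m,h}`: every vertex at level `1` has `m` children, hence degree
`m + 1`, and all the other non-leaf vertices have degree `2`. -/
def legDegrees (m i : ℕ) : ℕ := if i = 1 then m + 1 else 2

/-- The tree `L^z_{m,h}`. -/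
def legTree (z m h : ℕ) : SimpleGraph (LevelwiseVertex z h (legDegrees m)) :=
  levelwiseTree z h (legDegrees m)

/-! Lower bound. List the vertices by increasing label. As the diameter is `2h + z - 1`, a step
between levels `l` and `l'` costs at least `2h + 1 - l - l'`. Of three consecutive vertices two lie
on the same side, and this costs at least `z` more over the two steps when the middle one is a leaf
and neither outer one is central (`IsRadio.two_increments_ge`). Summing over all pairs of steps
counts the total level, one surplus per leaf, and a loss where a central vertex is next to a leaf
(`two_mul_increment_ge`). The best choice of the two end vertices gives the value; for `z = 1` it is
reached only after rounding up a half-integer.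

Upper bound. `nodeValue` visits the levels in the order `h, 2, h - 1, 3, …`, runs through the legs
of each level while alternating sides, and then visits the stems. Steps have the minimal cost, and
the leaf surplus is paid on each passage from side 0 to side 1. The zigzag keeps the lower of two
successive levels at most about `h / 2`, so two vertices of one leg, whose distance is small,
receive labels far enough apart. Levels that are not successive are separated by a whole
intermediate period (`levelNext_or_levelFar`). -/

/-! ### Distances in level-wise regular trees, computed from addresses. -/

/-- The distance in the infinite rooted tree whose vertices are the finite sequences of natural
numbers, the parent of a nonempty sequence being the sequence without its last entry. -/
def listDist : List ℕ → List ℕ → ℕ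
  | [], ys => ys.length
  | _ :: xs, [] => xs.length + 1
  | x :: xs, y :: ys => if x = y then listDist xs ys else xs.length + ys.length + 2

theorem listDist_nil_right (xs : List ℕ) : listDist xs [] = xs.length := by
  cases xs <;> simp [listDist]

theorem listDist_nil_left (xs : List ℕ) : listDist [] xs = xs.length := by
  simp [listDist]

theorem listDist_self (xs : List ℕ) : listDist xs xs = 0 := by
  induction xs <;> simp_all [listDist]

theorem listDist_append_singleton (c : ℕ) : ∀ xs ys : List ℕ,
    listDist xs (ys ++ [c]) ≤ listDist xs ys + 1 ∧
      listDist xs ys ≤ listDist xs (ys ++ [c]) + 1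
  | [], ys => by simp [listDist]; omega
  | x :: xs, [] => by
    simp only [listDist, List.nil_append, listDist_nil_right, List.length_nil]
    split_ifs <;> omega
  | x :: xs, y :: ys => by
    have := listDist_append_singleton c xs ys
    simp only [listDist, List.cons_append, List.length_append, List.length_singleton]
    split_ifs <;> omega

theorem listDist_replicate (a : ℕ) : ∀ i j : ℕ,
    listDist (List.replicate i a) (List.replicate j a) = (i - j) + (j - i)
  | 0, j => by simp [listDist]
  | i + 1, 0 => by simp [listDist, List.replicate_succ]
  | i + 1, j + 1 => by
    simp only [List.replicate_succ, listDist, if_true, listDist_replicate a i j]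
    omega

namespace LevelwiseVertex

variable {z h : ℕ} {d : ℕ → ℕ}

/-- The distance of two vertices in the level-wise regular tree, in terms of their addresses. -/
def addressDist (u v : LevelwiseVertex z h d) : ℕ :=
  if u.1.1 = v.1.1 then listDist u.1.2 v.1.2 else u.1.2.length + v.1.2.length + 1

theorem exists_of_append {i : Fin z} {p l : List ℕ} (v : LevelwiseVertex z h d)
    (hv : v.1 = (i, p ++ l)) : ∃ u : LevelwiseVertex z h d, u.1 = (i, p) := by
  obtain ⟨⟨i', q⟩, h1, h2⟩ := v
  obtain ⟨rfl, rfl⟩ := Prod.mk.inj hv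
  refine ⟨⟨(i', p), ?_, ?_⟩, rfl⟩
  · simp only [List.length_append] at h1
    change p.length ≤ h
    omega
  · intro j hj
    have hj' : j < (p ++ l).length := by
      simp only [List.length_append]
      exact Nat.lt_of_lt_of_le hj (Nat.le_add_right _ _)
    have := h2 j hj'
    simpa [List.getElem_append_left hj] using this

theorem addressDist_le_of_isChild {u v : LevelwiseVertex z h d} (w : LevelwiseVertex z h d)
    (huv : IsChild u v) :
    addressDist w v ≤ addressDist w u + 1 ∧ addressDist w u ≤ addressDist w v + 1 := by
  obtain ⟨h1, c, hc⟩ := huv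
  unfold addressDist
  rw [h1, hc]
  have := listDist_append_singleton c w.1.2 u.1.2
  simp only [List.length_append, List.length_singleton]
  split_ifs <;> omega

theorem addressDist_le_of_adj {u v : LevelwiseVertex z h d} (w : LevelwiseVertex z h d)
    (huv : (levelwiseTree z h d).Adj u v) : addressDist w v ≤ addressDist w u + 1 := by
  rcases huv with huv | huv | ⟨-, hu, hv⟩
  · exact (addressDist_le_of_isChild w huv).1
  · exact (addressDist_le_of_isChild w huv).2
  · unfold addressDist
    rw [hu, hv]
    simp only [listDist_nil_right, List.length_nil]
    split_ifs <;> omega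

/-- One edge changes the address distance by at most one; this is the half of `dist_eq_addressDist`
that needs no explicit walk. -/
theorem addressDist_le_length {u v : LevelwiseVertex z h d}
    (p : (levelwiseTree z h d).Walk u v) : addressDist v u ≤ p.length := by
  induction p with
  | nil => simp [addressDist, listDist_self]
  | @cons a b c hab p ih =>
    have := addressDist_le_of_adj c hab.symm
    rw [SimpleGraph.Walk.length_cons]
    omega

theorem exists_walk_of_append {i : Fin z} {p : List ℕ} (l : List ℕ)
    {u v : LevelwiseVertex z h d} (hu : u.1 = (i, p)) (hv : v.1 = (i, p ++ l)) :
    ∃ q : (levelwiseTree z h d).Walk u v, q.length = l.length := by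
  induction l using List.reverseRecOn generalizing v with
  | nil =>
    obtain rfl : u = v := Subtype.ext (by rw [hu, hv, List.append_nil])
    exact ⟨.nil, rfl⟩
  | append_singleton l c ih =>
    obtain ⟨w, hw⟩ := exists_of_append (p := p ++ l) (l := [c]) v
      (by rw [hv, List.append_assoc])
    obtain ⟨q, hq⟩ := ih hw
    have hadj : (levelwiseTree z h d).Adj w v :=
      Or.inl ⟨by rw [hv, hw], c, by rw [hv, hw, List.append_assoc]⟩
    exact ⟨q.concat hadj, by simp [hq]⟩

theorem exists_walk_of_common_prefix {i : Fin z} : ∀ (xs ys p : List ℕ)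
    {u v : LevelwiseVertex z h d}, u.1 = (i, p ++ xs) → v.1 = (i, p ++ ys) →
    ∃ q : (levelwiseTree z h d).Walk u v, q.length = listDist xs ys
  | [], ys, p, u, v, hu, hv => by
    simpa [listDist] using exists_walk_of_append ys (by simpa using hu) hv
  | x :: xs, [], p, u, v, hu, hv => by
    obtain ⟨q, hq⟩ := exists_walk_of_append (x :: xs) (by simpa using hv) hu
    exact ⟨q.reverse, by simp [hq, listDist]⟩
  | x :: xs, y :: ys, p, u, v, hu, hv => by
    by_cases hxy : x = y
    · subst hxy
      obtain ⟨q, hq⟩ := exists_walk_of_common_prefix xs ys (p ++ [x]) (u := u) (v := v)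
        (by simpa using hu) (by simpa using hv)
      exact ⟨q, by simp [hq, listDist]⟩
    · obtain ⟨w, hw⟩ := exists_of_append u hu
      obtain ⟨q, hq⟩ := exists_walk_of_append _ hw hu
      obtain ⟨q', hq'⟩ := exists_walk_of_append _ hw hv
      refine ⟨q.reverse.append q', ?_⟩
      simp [hq, hq', listDist, hxy]
      omega

theorem exists_walk_length_eq (u v : LevelwiseVertex z h d) :
    ∃ q : (levelwiseTree z h d).Walk u v, q.length = addressDist u v := by
  obtain ⟨i, xs, hu⟩ : ∃ i xs, u.1 = (i, xs) := ⟨_, _, rfl⟩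
  obtain ⟨j, ys, hv⟩ : ∃ j ys, v.1 = (j, ys) := ⟨_, _, rfl⟩
  by_cases hij : i = j
  · subst hij
    obtain ⟨q, hq⟩ := exists_walk_of_common_prefix xs ys [] hu hv
    exact ⟨q, by simp [hq, addressDist, hu, hv]⟩
  · obtain ⟨r, hr⟩ := exists_of_append (p := []) (l := xs) u hu
    obtain ⟨s, hs⟩ := exists_of_append (p := []) (l := ys) v hv
    obtain ⟨q, hq⟩ := exists_walk_of_append xs hr hu
    obtain ⟨q', hq'⟩ := exists_walk_of_append ys hs hv
    have hadj : (levelwiseTree z h d).Adj r s := by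
      refine Or.inr (Or.inr ⟨?_, by rw [hr], by rw [hs]⟩)
      rintro rfl
      exact hij (Prod.mk.inj (hr.symm.trans hs)).1
    refine ⟨(q.reverse.concat hadj).append q', ?_⟩
    simp [hq, hq', addressDist, hu, hv, hij]
    omega

theorem preconnected : (levelwiseTree z h d).Preconnected := fun u v =>
  (exists_walk_length_eq u v).elim fun q _ => ⟨q⟩

theorem dist_eq_addressDist (u v : LevelwiseVertex z h d) :
    (levelwiseTree z h d).dist u v = addressDist u v := by
  apply le_antisymm
  · obtain ⟨q, hq⟩ := exists_walk_length_eq u v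
    exact hq ▸ SimpleGraph.dist_le q
  · obtain ⟨p, hp⟩ := (preconnected v u).exists_walk_length_eq_dist
    rw [SimpleGraph.dist_comm, ← hp]
    exact addressDist_le_length p

end LevelwiseVertex

/-! ### Coordinates on the legs and the distance in terms of them. -/

/-- Coordinates for the vertices of `L^z_{m,h}`: a central vertex, one of the two vertices at
level `1` (one on each of the two sides), or the vertex at level `t + 2` of a leg on a side. -/
abbrev LegNode (z m h : ℕ) : Type := Fin z ⊕ Fin 2 ⊕ (Fin 2 × Fin m × Fin (h - 1))

namespace LegNode

variable {z m h : ℕ}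

/-- The level of a vertex. -/
def level : LegNode z m h → ℕ
  | .inl _ => 0
  | .inr (.inl _) => 1
  | .inr (.inr (_, _, t)) => t + 2

/-- The side on which a vertex lies. For `z = 1` the value at the centre is irrelevant. -/
def side : LegNode z m h → ℕ
  | .inl i => i
  | .inr (.inl s) => s
  | .inr (.inr (s, _, _)) => s

/-- The level of the last common ancestor of two vertices that lie on the same side. -/
def meet : LegNode z m h → LegNode z m h → ℕ
  | .inr (.inl _), .inr _ => 1
  | .inr (.inr _), .inr (.inl _) => 1
  | .inr (.inr (_, k, t)), .inr (.inr (_, k', t')) => if k = k' then min t.val t'.val + 2 else 1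
  | _, _ => 0

/-- The distance of two vertices. -/
def nodeDist (x y : LegNode z m h) : ℕ :=
  if x.side = y.side then x.level + y.level - 2 * meet x y else x.level + y.level + (z - 1)

/-- The vertices at level `1`, as a central vertex and the number of one of its children. -/
structure IsStemMap (m : ℕ) (br : Fin 2 → Fin z × ℕ) : Prop where
  injective : Function.Injective br
  lt_iff : ∀ i c, c < numChildren z (legDegrees m) 0 ↔ ∃ s, br s = (i, c)
  fst_eq_iff : ∀ i s, (br s).1 = i ↔ z = 1 ∨ s.val = i.val

/-- The address of a vertex in the level-wise regular tree. -/
def address (br : Fin 2 → Fin z × ℕ) : LegNode z m h → Fin z × List ℕ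
  | .inl i => (i, [])
  | .inr (.inl s) => ((br s).1, [(br s).2])
  | .inr (.inr (s, k, t)) => ((br s).1, (br s).2 :: k.val :: List.replicate t 0)

theorem numChildren_one : numChildren z (legDegrees m) 1 = m := by
  simp [numChildren, legDegrees]

theorem numChildren_add_two (j : ℕ) : numChildren z (legDegrees m) (j + 2) = 1 := by
  simp [numChildren, legDegrees]

/-- The vertex with given coordinates. -/
def toVertex {br : Fin 2 → Fin z × ℕ} (hbr : IsStemMap m br) (hh : 1 ≤ h) (x : LegNode z m h) :
    LevelwiseVertex z h (legDegrees m) :=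
  ⟨x.address br, by
    rcases x with i | s | ⟨s, k, t⟩
    · simp [address]
    · refine ⟨by simpa [address] using hh, fun j hj => ?_⟩
      obtain rfl : j = 0 := by simpa [address] using hj
      exact (hbr.lt_iff (br s).1 _).2 ⟨s, rfl⟩
    · refine ⟨by simp [address]; omega, fun j hj => ?_⟩
      match j with
      | 0 => exact (hbr.lt_iff (br s).1 _).2 ⟨s, rfl⟩
      | 1 => rw [numChildren_one]; exact k.2
      | j + 2 => rw [numChildren_add_two]; simp [address]⟩

/-- From level 2 on each vertex has at most one child, so an address is a stem, a leg number and a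
run of zeros, determined by its length. -/
theorem toVertex_bijective {br : Fin 2 → Fin z × ℕ} (hbr : IsStemMap m br) (hh : 1 ≤ h) :
    Function.Bijective (toVertex (h := h) hbr hh) := by
  constructor
  · intro x y hxy
    have hxy : x.address br = y.address br := congrArg Subtype.val hxy
    have key : ∀ s s', (br s).1 = (br s').1 → (br s).2 = (br s').2 → s = s' :=
      fun s s' h1 h2 => hbr.injective (Prod.ext h1 h2)
    rcases x with i | s | ⟨s, k, t⟩ <;> rcases y with i' | s' | ⟨s', k', t'⟩ <;>
      simp only [address, Prod.mk.injEq, List.cons.injEq, reduceCtorEq, and_false,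
        and_true] at hxy
    · rw [hxy]
    · rw [key s s' hxy.1 hxy.2]
    · obtain ⟨h1, h2, h3, h4⟩ := hxy
      have h5 : t = t' := Fin.ext (by simpa using congrArg List.length h4)
      rw [key s s' h1 h2, Fin.ext h3, h5]
  · rintro ⟨⟨i, l⟩, h1, h2⟩
    match l, h1, h2 with
    | [], h1, h2 => exact ⟨.inl i, rfl⟩
    | [c], h1, h2 =>
      obtain ⟨s, hs⟩ := (hbr.lt_iff i c).1 (h2 0 (by simp))
      exact ⟨.inr (.inl s), Subtype.ext (by simp [toVertex, address, hs])⟩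
    | c :: k :: l, h1, h2 =>
      obtain ⟨s, hs⟩ := (hbr.lt_iff i c).1 (h2 0 (by simp))
      have hk : k < m := by
        have := h2 1 (by simp)
        rwa [numChildren_one] at this
      have hl : l = List.replicate l.length 0 := by
        refine List.eq_replicate_iff.2 ⟨rfl, fun b hb => ?_⟩
        obtain ⟨j, hj, rfl⟩ := List.getElem_of_mem hb
        have := h2 (j + 2) (by simpa using hj)
        rw [numChildren_add_two] at this
        simpa using this
      have ht : l.length < h - 1 := by
        simp only [List.length_cons] at h1
        omega
      refine ⟨.inr (.inr (s, ⟨k, hk⟩, ⟨l.length, ht⟩)), Subtype.ext ?_⟩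
      simp only [toVertex, address, hs]
      rw [← hl]

theorem dist_toVertex {br : Fin 2 → Fin z × ℕ} (hbr : IsStemMap m br) (hh : 1 ≤ h)
    (hz : z = 1 ∨ z = 2) (x y : LegNode z m h) :
    (legTree z m h).dist (toVertex hbr hh x) (toVertex hbr hh y) = nodeDist x y := by
  have key : ∀ s s' : Fin 2, (br s).1 = (br s').1 ↔ z = 1 ∨ s.val = s'.val := by
    intro s s'
    have := (hbr.fst_eq_iff _ s').1 rfl
    rw [hbr.fst_eq_iff]
    omega
  have key' : ∀ s i, i = (br s).1 ↔ z = 1 ∨ s.val = i.val := by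
    intro s i
    rw [← hbr.fst_eq_iff, eq_comm]
  have key2 : ∀ s s' : Fin 2, z = 1 → ((br s).2 = (br s').2 ↔ s.val = s'.val) := by
    refine fun s s' h0 => ⟨fun h2 => ?_, fun h2 => by rw [Fin.ext h2]⟩
    exact congrArg Fin.val (hbr.injective (Prod.ext ((key s s').2 (Or.inl h0)) h2))
  have key3 : ∀ s s' : Fin 2, s.val = s'.val → (br s).2 = (br s').2 :=
    fun s s' h2 => by rw [Fin.ext h2]
  rw [legTree, LevelwiseVertex.dist_eq_addressDist]
  unfold LevelwiseVertex.addressDist nodeDist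
  simp only [toVertex]
  by_cases hs : x.side = y.side
  on_goal 1 => rw [if_pos hs]
  on_goal 2 => rw [if_neg hs]
  all_goals
    rcases x with i | s | ⟨s, k, t⟩ <;> rcases y with i' | s' | ⟨s', k', t'⟩ <;>
      simp only [side] at hs <;>
      simp only [address, level, meet, listDist_nil_left, listDist_nil_right, key, key',
        hbr.fst_eq_iff, List.length_cons, List.length_nil, List.length_replicate, listDist,
        listDist_replicate, Fin.ext_iff]
    case inr.inl.inr.inl | inr.inl.inr.inr | inr.inr.inr.inl | inr.inr.inr.inr =>
      have h1 := key2 s s'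
      have h2 := key3 s s'
      (repeat' split) <;> omega
    all_goals (repeat' split) <;> omega

end LegNode

/-! ### The diameter, and the radio number in coordinates. -/

namespace LegNode

variable {z m h : ℕ}

theorem level_le (hh : 1 ≤ h) (x : LegNode z m h) : x.level ≤ h := by
  rcases x with i | s | ⟨s, k, t⟩ <;> simp only [level] <;> omega

theorem nodeDist_le (hh : 1 ≤ h) (x y : LegNode z m h) : nodeDist x y ≤ 2 * h + (z - 1) := by
  have := x.level_le hh
  have := y.level_le hh
  unfold nodeDist
  split_ifs <;> omega

theorem exists_isStemMap (m : ℕ) (hz : z = 1 ∨ z = 2) :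
    ∃ br : Fin 2 → Fin z × ℕ, IsStemMap m br := by
  rcases hz with rfl | rfl
  -- With one centre the stems are its children 0 and 1; with two centres each stem is child 0 of
  -- its own centre.
  · refine ⟨fun s => (0, s), ?_, ?_, ?_⟩
    · intro s s' hs
      simpa [Fin.ext_iff] using hs
    · intro i c
      have : numChildren 1 (legDegrees m) 0 = 2 := by simp [numChildren, legDegrees]
      rw [this]
      constructor
      · exact fun hc => ⟨⟨c, hc⟩, Prod.ext (Subsingleton.elim _ _) rfl⟩
      · rintro ⟨s, hs⟩
        have := s.2
        have := congrArg Prod.snd hs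
        simp only at this
        omega
    · intro i s
      simp [Subsingleton.elim 0 i]
  · refine ⟨fun s => (s, 0), ?_, ?_, ?_⟩
    · intro s s' hs
      simpa using hs
    · intro i c
      have : numChildren 2 (legDegrees m) 0 = 1 := by simp [numChildren, legDegrees]
      rw [this]
      simp [eq_comm]
    · intro i s
      simp [Fin.ext_iff]

/-- A radio labelling of `L^z_{m,h}` in terms of the coordinates of its vertices. -/
def IsRadio (f : LegNode z m h → ℕ) : Prop :=
  ∀ x y, x ≠ y → (2 * h + z : ℤ) - nodeDist x y ≤ |(f x : ℤ) - f y|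

theorem diam_legTree {br : Fin 2 → Fin z × ℕ} (hbr : IsStemMap m br) (hm : 1 ≤ m) (hh : 2 ≤ h)
    (hz : z = 1 ∨ z = 2) : (legTree z m h).diam = 2 * h + (z - 1) := by
  have hh1 : 1 ≤ h := by omega
  have hbij := toVertex_bijective (h := h) hbr hh1
  -- Two leaves on opposite sides realise the diameter.
  let x : Fin 2 → LegNode z m h := fun s => .inr (.inr (s, ⟨0, hm⟩, ⟨h - 2, by omega⟩))
  have : Nonempty (LevelwiseVertex z h (legDegrees m)) := ⟨toVertex hbr hh1 (x 0)⟩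
  have : Finite (LevelwiseVertex z h (legDegrees m)) := Finite.of_surjective _ hbij.2
  have hpre : (legTree z m h).Preconnected := LevelwiseVertex.preconnected
  have hne : (legTree z m h).ediam ≠ ⊤ := SimpleGraph.connected_iff_ediam_ne_top.1 ⟨hpre⟩
  apply le_antisymm
  · obtain ⟨u, v, huv⟩ := SimpleGraph.exists_dist_eq_diam (G := legTree z m h)
    obtain ⟨x, rfl⟩ := hbij.2 u
    obtain ⟨y, rfl⟩ := hbij.2 v
    rw [← huv, dist_toVertex hbr hh1 hz]
    exact nodeDist_le hh1 x y
  · have h1 := SimpleGraph.dist_le_diam hne (u := toVertex hbr hh1 (x 0))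
      (v := toVertex hbr hh1 (x 1))
    rw [dist_toVertex hbr hh1 hz] at h1
    simp only [nodeDist, side, level, x] at h1
    simp at h1
    omega

/-- The radio number of `L^z_{m,h}` in terms of coordinates. -/
theorem radioNumber_legTree_eq (hm : 1 ≤ m) (hh : 2 ≤ h) (hz : z = 1 ∨ z = 2) {K : ℕ}
    (hlow : ∀ f : LegNode z m h → ℕ, IsRadio f → ∃ x y, (K : ℤ) ≤ (f x : ℤ) - f y)
    (hup : ∃ f : LegNode z m h → ℕ, IsRadio f ∧ (∀ x, f x ≤ K) ∧ (∃ x, f x = 0) ∧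
      ∃ x, f x = K) :
    radioNumber (legTree z m h) = K := by
  obtain ⟨br, hbr⟩ := exists_isStemMap m hz
  have hh1 : 1 ≤ h := by omega
  have hbij := toVertex_bijective (h := h) hbr hh1
  have hdiam : ((legTree z m h).diam : ℤ) + 1 = 2 * h + z := by
    rw [diam_legTree hbr hm hh hz]
    omega
  have hdist := dist_toVertex (h := h) hbr hh1 hz
  apply IsLeast.csInf_eq
  constructor
  · obtain ⟨f, hf, hle, ⟨x0, hx0⟩, x1, hx1⟩ := hup
    let e := Equiv.ofBijective _ hbij
    have he : ∀ x, e.symm (toVertex hbr hh1 x) = x := fun x => e.symm_apply_apply x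
    refine ⟨fun v => f (e.symm v), ?_, ?_, ?_⟩
    · intro u v huv
      obtain ⟨x, rfl⟩ := hbij.2 u
      obtain ⟨y, rfl⟩ := hbij.2 v
      rw [hdist, hdiam]
      simp only [he]
      exact hf x y fun hxy => huv (by rw [hxy])
    · refine ⟨toVertex hbr hh1 x1, toVertex hbr hh1 x0, ?_⟩
      simp [he, hx0, hx1]
    · rintro k ⟨u, v, hk⟩
      have h1 := hle (e.symm u)
      have h2 := hle (e.symm v)
      have h3 : |(f (e.symm u) : ℤ) - f (e.symm v)| ≤ K := abs_le.2 ⟨by omega, by omega⟩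
      simp only at hk
      omega
  · rintro k ⟨f, hf, hk⟩
    obtain ⟨x, y, hxy⟩ := hlow (fun x => f (toVertex hbr hh1 x)) (by
      intro x y hxy
      have := hf _ _ (hbij.1.ne hxy)
      rwa [hdist, hdiam] at this)
    have := hk.2 ⟨toVertex hbr hh1 x, toVertex hbr hh1 y, Int.natCast_natAbs _⟩
    omega

end LegNode

/-! ### The lower bound. -/

namespace LegNode

variable {z m h : ℕ}

/-- The leaves. -/
def leafIndicator (x : LegNode z m h) : ℤ := if x.level = h then 1 else 0

/-- The central vertices. -/
def centreIndicator (x : LegNode z m h) : ℤ := if x.level = 0 then 1 else 0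

theorem card_eq : Fintype.card (LegNode z m h) = z + 2 + 2 * m * (h - 1) := by
  simp [mul_assoc, add_assoc]

theorem sum_fin_add_two (n : ℕ) : ∑ t : Fin n, ((t.val + 2 : ℕ) : ℤ) * 2 = n * (n + 3) := by
  rw [Fin.sum_univ_eq_sum_range (fun t => ((t + 2 : ℕ) : ℤ) * 2)]
  induction n with
  | zero => simp
  | succ n ih =>
    rw [Finset.sum_range_succ, ih]
    push_cast
    ring

theorem sum_level (hh : 1 ≤ h) :
    ∑ x : LegNode z m h, (x.level : ℤ) = 2 + m * ((h - 1) * (h + 2)) := by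
  have := sum_fin_add_two (h - 1)
  simp only [Fintype.sum_sum_type, Fintype.sum_prod_type, level, Finset.sum_const,
    Finset.card_univ, Fintype.card_fin, nsmul_eq_mul]
  rw [← Finset.sum_mul, Nat.cast_sub hh] at this
  push_cast at *
  linear_combination (m : ℤ) * this

theorem sum_leafIndicator (hh : 2 ≤ h) :
    ∑ x : LegNode z m h, x.leafIndicator = 2 * m := by
  obtain ⟨n, rfl⟩ : ∃ n, h = n + 2 := ⟨h - 2, by omega⟩
  have h1 : ∀ t : Fin (n + 1), (t.val + 2 = n + 2) ↔ t = Fin.last n := by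
    intro t
    rw [Fin.ext_iff, Fin.val_last]
    omega
  simp only [Fintype.sum_sum_type, Fintype.sum_prod_type, leafIndicator, level]
  change _ + (_ + ∑ _ : Fin 2, ∑ _ : Fin m, ∑ t : Fin (n + 1), _) = _
  simp only [h1]
  simp

theorem sum_centreIndicator :
    ∑ x : LegNode z m h, x.centreIndicator = z := by
  simp only [Fintype.sum_sum_type, Fintype.sum_prod_type, centreIndicator, level]
  simp

theorem nodeDist_le_add (hz : 1 ≤ z) (x y : LegNode z m h) :
    (nodeDist x y : ℤ) ≤ x.level + y.level + (z - 1) := by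
  unfold nodeDist
  split_ifs <;> omega

/-- Both vertices are the stem of their side or descend from it, so the path between them avoids the
centre. -/
theorem nodeDist_le_of_side_eq {x y : LegNode z m h} (hxy : x.side = y.side)
    (hx : x.level ≠ 0) (hy : y.level ≠ 0) :
    (nodeDist x y : ℤ) ≤ x.level + y.level - 2 := by
  rw [nodeDist, if_pos hxy]
  have h1 : 1 ≤ meet x y := by
    rcases x with i | s | ⟨s, k, t⟩ <;> rcases y with i' | s' | ⟨s', k', t'⟩ <;>
      simp only [level, meet] at * <;> try omega
    split_ifs <;> omega
  omega

theorem side_lt_two (hz : z ≤ 2) (x : LegNode z m h) : x.side < 2 := by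
  rcases x with i | s | ⟨s, k, t⟩ <;> simp only [side] <;> omega

end LegNode

/-- Bounds for the increments over one and two steps of a sequence give a bound for the total
increment. -/
theorem two_mul_increment_ge (N : ℕ) (F L a b : ℕ → ℤ) (D c : ℤ) (hc : 0 ≤ c)
    (hb : ∀ i, 0 ≤ b i)
    (h1 : ∀ i ≤ N, D - L i - L (i + 1) ≤ F (i + 1) - F i)
    (h2 : ∀ i < N, 2 * D - L i - 2 * L (i + 1) - L (i + 2) + c * (a (i + 1) - b i - b (i + 2))
      ≤ F (i + 2) - F i) :
    2 * (N + 1) * D - 4 * ∑ i ∈ Finset.range (N + 2), L i + 2 * L 0 + 2 * L (N + 1)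
      + c * (∑ i ∈ Finset.range (N + 2), a i - 2 * ∑ i ∈ Finset.range (N + 2), b i
        - a 0 - a (N + 1) + b 0 + b (N + 1)) ≤ 2 * (F (N + 1) - F 0) := by
  have hsum : ∀ g : ℕ → ℤ, ∀ n, ∑ i ∈ Finset.range n, g (i + 1) =
      ∑ i ∈ Finset.range (n + 1), g i - g 0 := fun g n => by
    rw [Finset.sum_range_succ']
    ring
  have key := Finset.sum_le_sum fun i hi => h2 i (Finset.mem_range.1 hi)
  -- Adding the first and the last single step to this sum gives twice the total increment.
  have htel : ∑ i ∈ Finset.range N, (F (i + 2) - F i) = F (N + 1) + F N - F 1 - F 0 := by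
    clear h1 h2 key
    induction N with
    | zero => simp
    | succ n ih =>
      rw [Finset.sum_range_succ, ih]
      ring
  rw [htel] at key
  simp only [Finset.sum_add_distrib, Finset.sum_sub_distrib, ← Finset.mul_sum, Finset.sum_const,
    Finset.card_range, nsmul_eq_mul] at key
  have e1 := hsum L N
  have e2 := hsum (fun i => L (i + 1)) N
  have e3 := hsum L (N + 1)
  have e4 := hsum a N
  have e5 := hsum (fun i => b (i + 1)) N
  have e6 := hsum b (N + 1)
  have s1 := Finset.sum_range_succ L (N + 1)
  have s2 := Finset.sum_range_succ L N
  have s3 := Finset.sum_range_succ a (N + 1)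
  have s4 := Finset.sum_range_succ b (N + 1)
  have s5 := Finset.sum_range_succ b N
  simp only [add_assoc, Nat.reduceAdd, zero_add] at *
  -- The two-step sum counts `b 1` and `b N` once less than the stated bound does; nonnegativity
  -- absorbs this.
  have hb1 := mul_nonneg hc (hb 1)
  have hbN := mul_nonneg hc (hb N)
  have i1 := h1 0 (Nat.zero_le _)
  have i2 := h1 N le_rfl
  rw [e1, e2, e4, e5] at key
  rw [zero_add] at i1
  nlinarith

theorem exists_enumeration {V : Type*} [Fintype V] (f : V → ℕ) {n : ℕ}
    (hn : Fintype.card V = n) (hpos : 0 < n) : ∃ u : ℕ → V,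
      (∀ i < n, ∀ j < n, i < j → u i ≠ u j ∧ f (u i) ≤ f (u j)) ∧
      ∀ g : V → ℤ, ∑ i ∈ Finset.range n, g (u i) = ∑ x, g x := by
  let e := Fintype.equivFinOfCardEq hn
  let v : Fin n ≃ V := (Tuple.sort (f ∘ e.symm)).trans e.symm
  have hv : Monotone (f ∘ v) := Tuple.monotone_sort (f ∘ e.symm)
  let u : ℕ → V := fun i => if hi : i < n then v ⟨i, hi⟩ else v ⟨0, hpos⟩
  have hu : ∀ i (hi : i < n), u i = v ⟨i, hi⟩ := fun i hi => dif_pos hi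
  refine ⟨u, fun i hi j hj hij => ?_, fun g => ?_⟩
  · rw [hu i hi, hu j hj]
    refine ⟨fun h => ?_, hv (Fin.mk_le_mk.2 hij.le)⟩
    have := congrArg Fin.val (v.injective h)
    simp only at this
    omega
  · rw [← Equiv.sum_comp v, ← Fin.sum_univ_eq_sum_range (fun i => g (u i))]
    exact Finset.sum_congr rfl fun i _ => by rw [hu i i.2]

namespace LegNode

variable {z m h : ℕ}

theorem IsRadio.increment_ge {f : LegNode z m h → ℕ} (hf : IsRadio f) (hz : 1 ≤ z)
    {x y : LegNode z m h} (hxy : x ≠ y) (hle : f x ≤ f y) :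
    (2 * h + 1 : ℤ) - x.level - y.level ≤ f y - f x := by
  have h1 := hf x y hxy
  have h2 := nodeDist_le_add hz x y
  rw [abs_sub_comm, abs_of_nonneg (by omega)] at h1
  omega

theorem IsRadio.increment_ge_of_side_eq {f : LegNode z m h → ℕ} (hf : IsRadio f)
    {x y : LegNode z m h} (hxy : x ≠ y) (hle : f x ≤ f y) (hs : x.side = y.side)
    (hx : x.level ≠ 0) (hy : y.level ≠ 0) :
    (2 * h + z + 2 : ℤ) - x.level - y.level ≤ f y - f x := by
  have h1 := hf x y hxy
  have h2 := nodeDist_le_of_side_eq hs hx hy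
  rw [abs_sub_comm, abs_of_nonneg (by omega)] at h1
  omega

/-- Only the case of a leaf `y` between two non-central vertices exceeds the sum of the one-step
bounds. By pigeonhole two of the three share a side. If they are consecutive, that step gains `z +
1`; if they are `x` and `w`, the direct bound for this pair suffices because `y` has level `h`. -/
theorem IsRadio.two_increments_ge {f : LegNode z m h → ℕ} (hf : IsRadio f)
    (hz : z = 1 ∨ z = 2) (hh : 1 ≤ h) {x y w : LegNode z m h} (hxy : x ≠ y) (hyw : y ≠ w)
    (hxw : x ≠ w) (h1 : f x ≤ f y) (h2 : f y ≤ f w) :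
    2 * (2 * h + 1 : ℤ) - x.level - 2 * y.level - w.level
      + z * (y.leafIndicator - x.centreIndicator - w.centreIndicator) ≤ f w - f x := by
  have e1 := hf.increment_ge (by omega) hxy h1
  have e2 := hf.increment_ge (by omega) hyw h2
  have d1 := hf.increment_ge_of_side_eq hxy h1
  have d2 := hf.increment_ge_of_side_eq hyw h2
  have d3 := hf.increment_ge_of_side_eq hxw (h1.trans h2)
  have s1 := side_lt_two (by omega) x
  have s2 := side_lt_two (by omega) y
  have s3 := side_lt_two (by omega) w
  unfold leafIndicator centreIndicator
  rcases hz with rfl | rfl <;> split_ifs <;> omega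

theorem IsRadio.exists_sub_ge {f : LegNode z m h → ℕ} (hf : IsRadio f)
    (hz : z = 1 ∨ z = 2) (hh : 2 ≤ h) :
    ∃ x y, (2 * m * h * (h - 2) + (z + 2) * m + 2 * (z + 1) * h + 1 - 2 * z : ℤ) ≤ f x - f y := by
  obtain ⟨N, hN⟩ : ∃ N, Fintype.card (LegNode z m h) = N + 2 :=
    ⟨z + 2 * m * (h - 1), by rw [card_eq]; ring⟩
  have hNz : (N : ℤ) = z + 2 * m * (h - 1) := by
    have := hN.symm.trans card_eq
    have : N = z + 2 * m * (h - 1) := by omega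
    rw [this]
    push_cast [Nat.cast_sub (by omega : 1 ≤ h)]
    ring
  obtain ⟨u, hu, hsum⟩ := exists_enumeration f hN (by omega)
  have key := two_mul_increment_ge N (fun i => f (u i)) (fun i => (u i).level)
    (fun i => (u i).leafIndicator) (fun i => (u i).centreIndicator) (2 * h + 1) z (by positivity)
    (fun i => by unfold centreIndicator; split_ifs <;> simp)
    (fun i hi => by
      obtain ⟨h1, h2⟩ := hu i (by omega) (i + 1) (by omega) (by omega)
      exact hf.increment_ge (by omega) h1 h2)
    (fun i hi => by
      obtain ⟨h1, h2⟩ := hu i (by omega) (i + 1) (by omega) (by omega)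
      obtain ⟨h3, h4⟩ := hu (i + 1) (by omega) (i + 2) (by omega) (by omega)
      exact hf.two_increments_ge hz (by omega) h1 h3
        (hu i (by omega) (i + 2) (by omega) (by omega)).1 h2 h4)
  rw [hsum fun x => (x.level : ℤ), hsum leafIndicator, hsum centreIndicator,
    sum_level (by omega), sum_leafIndicator hh, sum_centreIndicator, hNz] at key
  refine ⟨u (N + 1), u 0, ?_⟩
  -- The contribution of an end vertex is smallest at a centre or a stem. Doubled, this settles `z =
  -- 2`.
  have hend : 1 ≤ ((u 0).level : ℤ) + (u 0).centreIndicator - (u 0).leafIndicator := by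
    unfold centreIndicator leafIndicator
    split_ifs <;> omega
  have hend' : 1 ≤ ((u (N + 1)).level : ℤ) + (u (N + 1)).centreIndicator
      - (u (N + 1)).leafIndicator := by
    unfold centreIndicator leafIndicator
    split_ifs <;> omega
  rcases hz with rfl | rfl
  -- With a single centre only one end can contribute 1; the other contributes at least 2.
  · have h3 : 3 ≤ 2 * ((u 0).level : ℤ) + (u 0).centreIndicator - (u 0).leafIndicator +
        (2 * ((u (N + 1)).level : ℤ) + (u (N + 1)).centreIndicator
          - (u (N + 1)).leafIndicator) := by
      have hne := (hu 0 (by omega) (N + 1) (by omega) (by omega)).1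
      have hcentre : ¬((u 0).level = 0 ∧ (u (N + 1)).level = 0) := by
        rintro ⟨h1, h2⟩
        revert hne h1 h2
        rcases u 0 with i | s | ⟨s, k, t⟩ <;> rcases u (N + 1) with i' | s' | ⟨s', k', t'⟩ <;>
          simp [level, eq_iff_true_of_subsingleton]
      unfold centreIndicator leafIndicator
      split_ifs <;> omega
    push_cast at key ⊢
    -- The deficit of 1 in the doubled inequality vanishes by integrality.
    have : (2 * (2 * m * h * (h - 2) + (1 + 2) * m + 2 * (1 + 1) * h + 1 - 2 * 1) : ℤ) - 1
        ≤ 2 * (f (u (N + 1)) - f (u 0)) := by linarith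
    generalize (2 * m * h * (h - 2) : ℤ) = c at *
    omega
  · push_cast at key ⊢
    linarith

end LegNode

/-! ### Arithmetic of the zigzag labels on the legs. -/

/-- The increment of the labels from a vertex at level `l` to the next vertex at level `l` on the
same side. -/
def legPeriod (h c l : ℤ) : ℤ := 4 * h + 2 - 4 * l + if l = h then c else 0

/-- The increment of the labels from a vertex at level `l` on the first side to its counterpart on
the second side. -/
def legShift (h c l : ℤ) : ℤ := 2 * h + 1 - 2 * l + if l = h then c else 0

/-- The sum of the periods of the levels preceding `l` in the order `h, 2, h - 1, 3, h - 2, …`. -/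
def legStart (h c l : ℤ) : ℤ :=
  if l = h then 0 else if h + 2 ≤ 2 * l then 4 * (h - l) * (h - 1) + c else 4 * (l - 2) * h + 2 + c

/-- The label, up to a constant, of the vertex at level `l` of the leg `k` on the side `s`. -/
def legValue (m h c s k l : ℤ) : ℤ :=
  m * legStart h c l - l + k * legPeriod h c l + s * legShift h c l

/-- The level `l'` immediately follows `l` in the order `h, 2, h - 1, 3, h - 2, …`. -/
def LevelNext (h c l l' : ℤ) : Prop :=
  legStart h c l' = legStart h c l + legPeriod h c l ∧
    ((l' < l ∧ l + l' = h + 2) ∨ (l < l' ∧ l + l' = h + 1))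

/-- The level `l'` follows `l`, but not immediately, in the order `h, 2, h - 1, 3, h - 2, …`. -/
def LevelFar (h c l l' : ℤ) : Prop :=
  min l l' + 1 ≤ legStart h c l' - legStart h c l - legPeriod h c l

/-- Between two high levels the order passes through the low level `h + 2 - l`, whose period `4l -
6` supplies the gap. A low level after `h + 2 - l` comes at least one low-high pair later, and such
a pair has total period `4h`. -/
theorem levelNext_or_levelFar_of_high {h c l l' : ℤ} (hh : 2 ≤ h) (hlh : l ≤ h)
    (hl' : 2 ≤ l') (hlh' : l' ≤ h) (hl : h + 2 ≤ 2 * l)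
    (hne : (h + 2 ≤ 2 * l' ∧ l' < l) ∨ (2 * l' < h + 2 ∧ h + 2 ≤ l + l')) :
    LevelNext h c l l' ∨ LevelFar h c l l' := by
  unfold LevelNext LevelFar legStart legPeriod
  rcases hne with ⟨h1, h2⟩ | ⟨h1, h2⟩
  · right
    rw [min_eq_right h2.le, if_neg (by omega : l' ≠ h), if_pos h1]
    have := mul_nonneg (by omega : 0 ≤ l - l' - 1) (by omega : 0 ≤ h - 1)
    split_ifs <;> nlinarith
  · rw [if_neg (by omega : l' ≠ h), if_neg (by omega : ¬ h + 2 ≤ 2 * l'),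
      min_eq_right (by omega : l' ≤ l)]
    rcases h2.eq_or_lt with h3 | h3
    · left
      obtain rfl : l' = h + 2 - l := by omega
      refine ⟨?_, Or.inl ⟨by omega, by omega⟩⟩
      split_ifs with h4
      · subst h4; ring
      · ring
    · right
      have := mul_nonneg (by omega : 0 ≤ l + l' - h - 3) (by omega : 0 ≤ h)
      split_ifs with h4
      · subst h4; nlinarith
      · nlinarith

theorem levelNext_or_levelFar_of_low {h c l l' : ℤ} (hh : 2 ≤ h) (hl2 : 2 ≤ l)
    (hl' : 2 ≤ l') (hlh' : l' ≤ h) (hl : 2 * l < h + 2)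
    (hne : (h + 2 ≤ 2 * l' ∧ l + l' < h + 2) ∨ (2 * l' < h + 2 ∧ l < l')) :
    LevelNext h c l l' ∨ LevelFar h c l l' := by
  unfold LevelNext LevelFar legStart legPeriod
  rw [if_neg (by omega : l ≠ h), if_neg (by omega : ¬ h + 2 ≤ 2 * l),
    if_neg (by omega : l ≠ h), if_neg (by omega : l' ≠ h), min_eq_left (by omega : l ≤ l')]
  rcases hne with ⟨h1, h2⟩ | ⟨h1, h2⟩
  · rw [if_pos h1]
    rcases (by omega : l + l' = h + 1 ∨ l + l' ≤ h) with h3 | h3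
    · left
      obtain rfl : l' = h + 1 - l := by omega
      exact ⟨by ring, Or.inr ⟨by omega, by omega⟩⟩
    · right
      have := mul_nonneg (by omega : 0 ≤ h - l - l') (by omega : 0 ≤ h - 1)
      nlinarith
  · right
    rw [if_neg (by omega : ¬ h + 2 ≤ 2 * l')]
    have := mul_nonneg (by omega : 0 ≤ l' - l - 1) (by omega : 0 ≤ h)
    nlinarith

theorem levelNext_or_levelFar {h c l l' : ℤ} (hh : 2 ≤ h) (hl : 2 ≤ l) (hlh : l ≤ h)
    (hl' : 2 ≤ l') (hlh' : l' ≤ h) (hne : l ≠ l') :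
    (LevelNext h c l l' ∨ LevelFar h c l l') ∨ LevelNext h c l' l ∨ LevelFar h c l' l := by
  by_cases h1 : h + 2 ≤ 2 * l <;> by_cases h2 : h + 2 ≤ 2 * l'
  · rcases hne.lt_or_gt with h3 | h3
    · exact Or.inr (levelNext_or_levelFar_of_high hh hlh' hl hlh h2 (by omega))
    · exact Or.inl (levelNext_or_levelFar_of_high hh hlh hl' hlh' h1 (by omega))
  · by_cases h3 : h + 2 ≤ l + l'
    · exact Or.inl (levelNext_or_levelFar_of_high hh hlh hl' hlh' h1 (by omega))
    · exact Or.inr (levelNext_or_levelFar_of_low hh hl' hl hlh (by omega) (by omega))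
  · by_cases h3 : h + 2 ≤ l + l'
    · exact Or.inr (levelNext_or_levelFar_of_high hh hlh' hl hlh h2 (by omega))
    · exact Or.inl (levelNext_or_levelFar_of_low hh hl hl' hlh' (by omega) (by omega))
  · rcases hne.lt_or_gt with h3 | h3
    · exact Or.inl (levelNext_or_levelFar_of_low hh hl hl' hlh' (by omega) (by omega))
    · exact Or.inr (levelNext_or_levelFar_of_low hh hl' hl hlh (by omega) (by omega))

/-- The right side is the sum of the periods of all levels from 2 to `h`. -/
theorem legStart_add_legPeriod_le {h c l : ℤ} (hh : 2 ≤ h) (hl : 2 ≤ l) :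
    legStart h c l + legPeriod h c l ≤ 2 * (h - 1) ^ 2 + c := by
  unfold legStart legPeriod
  split_ifs <;> nlinarith

theorem legStart_nonneg {h c l : ℤ} (hh : 2 ≤ h) (hc : 1 ≤ c) (hl : 2 ≤ l) (hlh : l ≤ h) :
    0 ≤ legStart h c l := by
  unfold legStart
  split_ifs
  · rfl
  · have := mul_nonneg (sub_nonneg.2 hlh) (by omega : 0 ≤ h - 1)
    linarith
  · have := mul_nonneg (sub_nonneg.2 hl) (by omega : 0 ≤ h)
    linarith

theorem legStart_ge {h c l : ℤ} (hh : 2 ≤ h) (hl : 2 ≤ l) (hlh : l < h) :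
    2 + c ≤ legStart h c l := by
  unfold legStart
  split_ifs
  · omega
  · nlinarith [mul_nonneg (by omega : 0 ≤ h - l - 1) (by omega : 0 ≤ h - 1)]
  · have := mul_nonneg (sub_nonneg.2 hl) (by omega : 0 ≤ h)
    linarith

theorem legPeriod_pos {h c l : ℤ} (hc : 1 ≤ c) (hlh : l ≤ h) : 0 < legPeriod h c l := by
  unfold legPeriod
  split_ifs <;> omega

theorem legShift_pos {h c l : ℤ} (hc : 1 ≤ c) (hlh : l ≤ h) : 0 < legShift h c l := by
  unfold legShift
  split_ifs <;> omega

/-- The return from side 1 to side 0 has the minimal cost: the whole leaf surplus sits in the shift.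
-/
theorem legPeriod_eq (h c l : ℤ) : legPeriod h c l = legShift h c l + (2 * h + 1 - 2 * l) := by
  unfold legPeriod legShift
  ring

section

variable {m h c s k l s' k' l' : ℤ}

theorem legValue_sub_of_far (hc : 1 ≤ c) (hm : 2 ≤ m) (hl : 2 ≤ l) (hlh : l ≤ h)
    (hl' : 2 ≤ l') (hlh' : l' ≤ h) (hk : k < m) (hk' : 0 ≤ k') (hs : s = 0 ∨ s = 1)
    (hs' : s' = 0 ∨ s' = 1) (hc2 : c ≤ 2) (hfar : LevelFar h c l l') :
    2 * h + c - l - l' + 2 * min l l' ≤ legValue m h c s' k' l' - legValue m h c s k l := by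
  have hP := legPeriod_pos hc hlh
  have hP' := legPeriod_pos hc hlh'
  have hQ := legShift_pos hc hlh
  have hQ' := legShift_pos hc hlh'
  have hPQ := legPeriod_eq h c l
  unfold LevelFar at hfar
  unfold legValue
  generalize legPeriod h c l = P at *
  generalize legPeriod h c l' = P' at *
  generalize legShift h c l = Q at *
  generalize legShift h c l' = Q' at *
  generalize legStart h c l = G at *
  generalize legStart h c l' = G' at *
  have hmin : 2 ≤ min l l' := le_min hl hl'
  -- The gap of `LevelFar` occurs once per leg, so `2 ≤ m` doubles it to cover the term `2 * min l
  -- l'`.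
  have e1 := mul_le_mul_of_nonneg_right hm (by omega : 0 ≤ G' - G - P)
  have e2 := mul_nonneg (by omega : 0 ≤ m - 1 - k) hP.le
  have e3 := mul_nonneg hk' hP'.le
  rcases hs with rfl | rfl <;> rcases hs' with rfl | rfl <;> nlinarith

/-- The term `-l` in `legValue` makes the passage from the last vertex of a level to the first of
the next cost exactly `2h + 1 - l - l'`. The three bounds serve opposite sides, equal sides, and
equal legs. -/
theorem legValue_sub_of_next (hc : 1 ≤ c) (hm : 2 ≤ m) (hl : 2 ≤ l) (hlh : l ≤ h)
    (hlh' : l' ≤ h) (hk : k < m) (hk' : 0 ≤ k') (hs : s = 0 ∨ s = 1)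
    (hs' : s' = 0 ∨ s' = 1) (hc2 : c ≤ 2) (hnext : LevelNext h c l l') :
    2 * h + 1 - l - l' ≤ legValue m h c s' k' l' - legValue m h c s k l ∧
    (s = s' → 2 * h + c + 2 - l - l' ≤ legValue m h c s' k' l' - legValue m h c s k l) ∧
    (s = s' → k = k' →
      2 * h + c - l - l' + 2 * min l l' ≤ legValue m h c s' k' l' - legValue m h c s k l) := by
  have hP := legPeriod_pos hc hlh
  have hP' := legPeriod_pos hc hlh'
  have hQ := legShift_pos hc hlh
  have hQ' := legShift_pos hc hlh'
  have hPQ := legPeriod_eq h c l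
  have dQ : legShift h c l = 2 * h + 1 - 2 * l + if l = h then c else 0 := rfl
  have dQ' : legShift h c l' = 2 * h + 1 - 2 * l' + if l' = h then c else 0 := rfl
  have hPQ' := legPeriod_eq h c l'
  obtain ⟨hG, hll⟩ := hnext
  unfold legValue
  rw [hG]
  generalize legPeriod h c l = P at *
  generalize legPeriod h c l' = P' at *
  generalize legShift h c l = Q at *
  generalize legShift h c l' = Q' at *
  generalize legStart h c l = G at *
  have e2 := mul_nonneg (by omega : 0 ≤ m - 1 - k) hP.le
  have e3 := mul_nonneg hk' hP'.le
  -- On one leg the weights add up to `m - 1 ≥ 1`, so at least one full period is gained.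
  have e4 : k = k' → min P P' ≤ (m - 1 - k) * P + k' * P' := by
    rintro rfl
    have h1 := mul_le_mul_of_nonneg_left (min_le_left P P') (by omega : 0 ≤ m - 1 - k)
    have h2 := mul_le_mul_of_nonneg_left (min_le_right P P') hk'
    have h3 : 0 < min P P' := lt_min hP hP'
    nlinarith
  have e5 : m * (G + P) - m * G = m * P := by ring
  have e6 : (m - 1 - k) * P = m * P - P - k * P := by ring
  rw [e6] at e2 e4
  generalize m * (G + P) = A at *
  generalize m * G = B at *
  generalize m * P = C at *
  generalize k * P = E at *
  generalize k' * P' = E' at *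
  refine ⟨?_, ?_, ?_⟩
  · rcases hs with rfl | rfl <;> rcases hs' with rfl | rfl <;> split_ifs at * <;> omega
  · rcases hs with rfl | rfl <;> rcases hs' with rfl | rfl <;> split_ifs at * <;> omega
  · intro h1 h2
    have e4 := e4 h2
    rcases hs with rfl | rfl <;> rcases hs' with rfl | rfl <;> split_ifs at * <;> omega

theorem legValue_sub_of_lt (hc : 1 ≤ c) (hlh : l ≤ h) (hkk : k < k') (hs : s = 0 ∨ s = 1)
    (hs' : s' = 0 ∨ s' = 1) (hc2 : c ≤ 2) :
    2 * h + 1 - l - l ≤ legValue m h c s' k' l - legValue m h c s k l ∧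
    (s = s' → 2 * h + c + 2 - l - l ≤ legValue m h c s' k' l - legValue m h c s k l) := by
  have hP := legPeriod_pos hc hlh
  have hQ := legShift_pos hc hlh
  have hPQ := legPeriod_eq h c l
  have dQ : legShift h c l = 2 * h + 1 - 2 * l + if l = h then c else 0 := rfl
  unfold legValue
  generalize legPeriod h c l = P at *
  generalize legShift h c l = Q at *
  generalize legStart h c l = G at *
  have e1 := mul_nonneg (by omega : 0 ≤ k' - k - 1) hP.le
  have e2 : (k' - k - 1) * P = k' * P - k * P - P := by ring
  rw [e2] at e1
  generalize k * P = E at *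
  generalize k' * P = E' at *
  generalize m * G = B at *
  refine ⟨?_, ?_⟩
  · rcases hs with rfl | rfl <;> rcases hs' with rfl | rfl <;> split_ifs at * <;> omega
  · rcases hs with rfl | rfl <;> rcases hs' with rfl | rfl <;> split_ifs at * <;> omega

theorem legValue_sub_zero_one (hc : 1 ≤ c) :
    2 * h + 1 - l - l ≤ legValue m h c 1 k l - legValue m h c 0 k l := by
  unfold legValue legShift
  split_ifs <;> linarith

/-- The total `m * (2 * (h - 1) ^ 2 + c)` is where a further level would start; on side 0 the shift
to side 1 is still to come. -/
theorem sub_legValue (hc : 1 ≤ c) (hm : 2 ≤ m) (hh : 2 ≤ h) (hl : 2 ≤ l) (hlh : l ≤ h)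
    (hk : k < m) (hs : s = 0 ∨ s = 1) (hc2 : c ≤ 2) :
    2 * h + 1 - l ≤ m * (2 * (h - 1) ^ 2 + c) - legValue m h c s k l ∧
    (s = 0 → 2 * h + c + 2 - l ≤ m * (2 * (h - 1) ^ 2 + c) - legValue m h c s k l) := by
  have hP := legPeriod_pos hc hlh
  have hQ := legShift_pos hc hlh
  have hPQ := legPeriod_eq h c l
  have dQ : legShift h c l = 2 * h + 1 - 2 * l + if l = h then c else 0 := rfl
  have hM := legStart_add_legPeriod_le (c := c) hh hl
  unfold legValue
  generalize 2 * (h - 1) ^ 2 + c = M at *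
  generalize legPeriod h c l = P at *
  generalize legShift h c l = Q at *
  generalize legStart h c l = G at *
  have e1 := mul_nonneg (by omega : 0 ≤ m - 1 - k) hP.le
  have e2 := mul_nonneg (by omega : 0 ≤ m) (by omega : 0 ≤ M - G - P)
  have e3 : (m - 1 - k) * P = m * P - P - k * P := by ring
  have e4 : m * (M - G - P) = m * M - m * G - m * P := by ring
  rw [e3] at e1
  rw [e4] at e2
  generalize k * P = E at *
  generalize m * P = E' at *
  generalize m * G = B at *
  generalize m * M = B' at *
  refine ⟨?_, ?_⟩
  · rcases hs with rfl | rfl <;> split_ifs at * <;> omega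
  · rcases hs with rfl | rfl <;> split_ifs at * <;> omega

theorem legValue_add_nonneg (hc : 1 ≤ c) (hm : 0 ≤ m) (hh : 2 ≤ h) (hl : 2 ≤ l) (hlh : l ≤ h)
    (hk : 0 ≤ k) (hs : s = 0 ∨ s = 1) : 0 ≤ legValue m h c s k l + l := by
  have hQ := legShift_pos hc hlh
  have e1 := mul_nonneg hk (legPeriod_pos hc hlh).le
  have e2 := mul_nonneg hm (legStart_nonneg hh hc hl hlh)
  unfold legValue
  rcases hs with rfl | rfl <;> linarith

/-- For `z = 2` this keeps the legs away from the centre labelled 0, which lies on side 0. The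
excluded leaf is the one that would come first; it is too close and gets a late label instead. -/
theorem legValue_add_ge (hm : 2 ≤ m) (hh : 2 ≤ h) (hl : 2 ≤ l) (hlh : l ≤ h)
    (hk : 0 ≤ k) (hs : s = 0 ∨ s = 1) (hne : ¬(s = 0 ∧ k = 0 ∧ l = h)) :
    4 - s ≤ legValue m h 2 s k l + l := by
  have hc : (1 : ℤ) ≤ 2 := by norm_num
  have hP := legPeriod_pos hc hlh
  have hQ := legShift_pos hc hlh
  have dQ : legShift h 2 l = 2 * h + 1 - 2 * l + if l = h then 2 else 0 := rfl
  have hPQ := legPeriod_eq h 2 l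
  have e1 := mul_nonneg hk hP.le
  have e2 := mul_nonneg (by omega : 0 ≤ m) (legStart_nonneg hh hc hl hlh)
  unfold legValue
  rcases hlh.eq_or_lt with h1 | h1
  · rcases hs with rfl | rfl
    · rw [if_pos h1] at dQ
      have := mul_le_mul_of_nonneg_right (by omega : 1 ≤ k) hP.le
      linarith
    · rw [if_pos h1] at dQ
      linarith
  · have h2 := legStart_ge (c := 2) hh hl h1
    have h3 := mul_le_mul_of_nonneg_left h2 (by omega : 0 ≤ m)
    rcases hs with rfl | rfl <;> linarith

end

/-! ### The labelling of the whole tree, and the upper bound. -/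

namespace LegNode

variable {z m h : ℕ}

theorem le_nodeDist (hz : 1 ≤ z) (x y : LegNode z m h) :
    (x.side ≠ y.side → (x.level + y.level + z - 1 : ℤ) ≤ nodeDist x y) ∧
      (x.side = y.side → (x.level + y.level - 2 * meet x y : ℤ) ≤ nodeDist x y) := by
  unfold nodeDist
  constructor <;> intro hxy
  · rw [if_neg hxy]
    omega
  · rw [if_pos hxy]
    omega

theorem meet_comm (x y : LegNode z m h) : meet x y = meet y x := by
  rcases x with i | s | ⟨s, k, t⟩ <;> rcases y with i' | s' | ⟨s', k', t'⟩ <;>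
    simp only [meet, eq_comm, min_comm]

theorem nodeDist_comm (x y : LegNode z m h) : nodeDist x y = nodeDist y x := by
  unfold nodeDist
  simp only [meet_comm x y, add_comm x.level, eq_comm (a := x.side)]

/-- The common part `m (2 (h - 1) ^ 2 + z)` of the labels of the last vertices. -/
def legTotal (z m h : ℕ) : ℤ := m * (2 * ((h : ℤ) - 1) ^ 2 + z)

/-- A radio labelling of `L^z_{m,h}`. If `z = 2`, then one of the leaves takes the second largest
label. -/
def nodeValue : LegNode z m h → ℤ
  | .inl i => i * (legTotal z m h + 6 * h - 3)
  -- The stems continue the leg pattern with `l = 1` and shift `2h + 1 - 2l`.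
  | .inr (.inl s) => 2 * h + 4 - 3 * z + legTotal z m h - 1 + s * (2 * h - 1)
  | .inr (.inr (s, k, t)) =>
    -- This leaf falls between the second stem and the second centre, both on the other side, at
    -- minimal cost.
    if z = 2 ∧ s.val = 0 ∧ k.val = 0 ∧ t.val + 2 = h then legTotal z m h + 5 * h - 4
    -- The offset gives the first leaf after the centre labelled 0 the label `h + 1`: on side 0 for
    -- `z = 1`, on side 1 for `z = 2`.
    else 2 * h + 4 - 3 * z + legValue m h z s k (t + 2)

/-- The condition of a radio labelling for two vertices. -/
def Separated (x y : LegNode z m h) : Prop :=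
  (2 * h + z : ℤ) - nodeDist x y ≤ |nodeValue x - nodeValue y|

theorem Separated.symm {x y : LegNode z m h} (hxy : Separated x y) : Separated y x := by
  unfold Separated at *
  rwa [nodeDist_comm, abs_sub_comm]

theorem separated_of_le {x y : LegNode z m h}
    (hxy : (2 * h + z : ℤ) - nodeDist x y ≤ nodeValue y - nodeValue x) : Separated x y :=
  hxy.trans (by rw [abs_sub_comm]; exact le_abs_self _)

theorem legTotal_ge (hm : 2 ≤ m) (hh : 2 ≤ h) : (4 + 2 * z : ℤ) ≤ legTotal z m h := by
  unfold legTotal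
  have h1 : (1 : ℤ) ≤ ((h : ℤ) - 1) ^ 2 := one_le_pow₀ (by omega)
  have := mul_le_mul_of_nonneg_right (by omega : (2 : ℤ) ≤ m)
    (by omega : (0 : ℤ) ≤ 2 * ((h : ℤ) - 1) ^ 2 + z)
  linarith

theorem fin_two_cases (s : Fin 2) : (s.val : ℤ) = 0 ∨ (s.val : ℤ) = 1 := by omega

theorem separated_leg_leg_of_level_eq (hz : z = 1 ∨ z = 2) {s s' : Fin 2}
    {k k' : Fin m} {t : Fin (h - 1)} (hkk : k < k')
    (hx : ¬(z = 2 ∧ s.val = 0 ∧ k.val = 0 ∧ t.val + 2 = h))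
    (hy : ¬(z = 2 ∧ s'.val = 0 ∧ k'.val = 0 ∧ t.val + 2 = h)) :
    Separated (z := z) (.inr (.inr (s, k, t))) (.inr (.inr (s', k', t))) := by
  apply separated_of_le
  have h1 := le_nodeDist (by omega) (.inr (.inr (s, k, t)) : LegNode z m h)
    (.inr (.inr (s', k', t)))
  have h2 := legValue_sub_of_lt (m := m) (h := h) (c := z) (l := t + 2) (by omega) (by omega)
    (Nat.cast_lt.2 (Fin.lt_def.1 hkk)) (fin_two_cases s) (fin_two_cases s') (by omega)
  simp only [side, level, meet, nodeValue, if_neg hx, if_neg hy, if_neg hkk.ne] at *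
  by_cases hs : s.val = s'.val <;> omega

theorem separated_leg_leg_of_next_or_far (hz : z = 1 ∨ z = 2) (hm : 2 ≤ m) {s s' : Fin 2}
    {k k' : Fin m} {t t' : Fin (h - 1)}
    (htt : LevelNext h z (t + 2) (t' + 2) ∨ LevelFar h z (t + 2) (t' + 2))
    (hx : ¬(z = 2 ∧ s.val = 0 ∧ k.val = 0 ∧ t.val + 2 = h))
    (hy : ¬(z = 2 ∧ s'.val = 0 ∧ k'.val = 0 ∧ t'.val + 2 = h)) :
    Separated (z := z) (.inr (.inr (s, k, t))) (.inr (.inr (s', k', t'))) := by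
  apply separated_of_le
  have h1 := le_nodeDist (by omega) (.inr (.inr (s, k, t)) : LegNode z m h)
    (.inr (.inr (s', k', t')))
  have hs := fin_two_cases s
  have hs' := fin_two_cases s'
  simp only [side, level, meet, nodeValue, if_neg hx, if_neg hy] at *
  rcases htt with htt | htt
  · have h2 := legValue_sub_of_next (m := m) (k := k) (k' := k') (by omega) (by omega)
      (by omega) (by omega) (by omega) (by omega) (by omega) hs hs' (by omega) htt
    by_cases hss : s.val = s'.val <;> by_cases hkk : k = k'
    · rw [if_pos hkk] at h1
      have := congrArg Fin.val hkk
      omega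
    · rw [if_neg hkk] at h1
      omega
    all_goals omega
  · have h2 := legValue_sub_of_far (m := m) (k := k) (k' := k') (by omega) (by omega)
      (by omega) (by omega) (by omega) (by omega) (by omega) (by omega) hs hs' (by omega) htt
    have h3 : (2 : ℤ) ≤ min (t.val + 2 : ℤ) (t'.val + 2) := le_min (by omega) (by omega)
    by_cases hss : s.val = s'.val
    · by_cases hkk : k = k'
      · rw [if_pos hkk] at h1
        omega
      · rw [if_neg hkk] at h1
        omega
    · omega

theorem separated_leg_leg (hz : z = 1 ∨ z = 2) (hm : 2 ≤ m) (hh : 2 ≤ h) {s s' : Fin 2}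
    {k k' : Fin m} {t t' : Fin (h - 1)} (hne : ¬(s = s' ∧ k = k' ∧ t = t'))
    (hx : ¬(z = 2 ∧ s.val = 0 ∧ k.val = 0 ∧ t.val + 2 = h))
    (hy : ¬(z = 2 ∧ s'.val = 0 ∧ k'.val = 0 ∧ t'.val + 2 = h)) :
    Separated (z := z) (.inr (.inr (s, k, t))) (.inr (.inr (s', k', t'))) := by
  by_cases ht : t = t'
  · subst ht
    rcases lt_trichotomy k k' with hk | hk | hk
    · exact separated_leg_leg_of_level_eq hz hk hx hy
    · subst hk
      have key : ∀ s s' : Fin 2, s.val = 0 → s'.val = 1 →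
          ¬(z = 2 ∧ s.val = 0 ∧ k.val = 0 ∧ t.val + 2 = h) →
          Separated (z := z) (.inr (.inr (s, k, t))) (.inr (.inr (s', k, t))) := by
        intro s s' hs hs' hx
        apply separated_of_le
        have h1 := le_nodeDist (by omega) (.inr (.inr (s, k, t)) : LegNode z m h)
          (.inr (.inr (s', k, t)))
        have h2 := legValue_sub_zero_one (m := m) (h := h) (c := z) (k := k) (l := t + 2)
          (by omega)
        have hy : ¬(z = 2 ∧ s'.val = 0 ∧ k.val = 0 ∧ t.val + 2 = h) := by omega
        simp only [side, level, meet, nodeValue, if_neg hx, if_neg hy] at h1 h2 ⊢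
        rw [hs, hs'] at h1 ⊢
        push_cast at h1 ⊢
        omega
      have hs : s.val ≠ s'.val := fun h0 => hne ⟨Fin.ext h0, rfl, rfl⟩
      rcases (by omega : s.val = 0 ∧ s'.val = 1 ∨ s'.val = 0 ∧ s.val = 1) with ⟨h1, h2⟩ | ⟨h1, h2⟩
      · exact key s s' h1 h2 hx
      · exact (key s' s h1 h2 hy).symm
    · exact (separated_leg_leg_of_level_eq hz hk hy hx).symm
  · have ht' : t.val ≠ t'.val := fun h0 => ht (Fin.ext h0)
    rcases levelNext_or_levelFar (h := h) (c := z) (l := t + 2) (l' := t' + 2) (by omega)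
      (by omega) (by omega) (by omega) (by omega) (by omega) with htt | htt
    · exact separated_leg_leg_of_next_or_far hz hm htt hx hy
    · exact (separated_leg_leg_of_next_or_far hz hm htt hy hx).symm

theorem nodeValue_leg_le (hz : z = 1 ∨ z = 2) (hm : 2 ≤ m) (hh : 2 ≤ h) {s : Fin 2}
    {k : Fin m} {t : Fin (h - 1)}
    (hx : ¬(z = 2 ∧ s.val = 0 ∧ k.val = 0 ∧ t.val + 2 = h)) :
    let v := nodeValue (z := z) (.inr (.inr (s, k, t)) : LegNode z m h)
    v ≤ legTotal z m h + 5 + t - 3 * z ∧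
      (s.val = 0 → v ≤ legTotal z m h + 4 + t - 4 * z) := by
  have := sub_legValue (m := m) (h := h) (c := z) (k := k) (l := t + 2) (by omega) (by omega)
    (by omega) (by omega) (by omega) (by omega) (fin_two_cases s) (by omega)
  simp only [nodeValue, if_neg hx, legTotal]
  omega

theorem nodeValue_leg_ge (hz : z = 1 ∨ z = 2) (hm : 2 ≤ m) (hh : 2 ≤ h) {s : Fin 2}
    {k : Fin m} {t : Fin (h - 1)}
    (hx : ¬(z = 2 ∧ s.val = 0 ∧ k.val = 0 ∧ t.val + 2 = h)) :
    let v := nodeValue (z := z) (.inr (.inr (s, k, t)) : LegNode z m h)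
    (2 * h + 2 - 3 * z - t : ℤ) ≤ v ∧ (z = 2 → (2 * h - t - s : ℤ) ≤ v) := by
  have h1 := legValue_add_nonneg (m := m) (h := h) (c := z) (k := k) (l := t + 2) (by omega)
    (by omega) (by omega) (by omega) (by omega) (by omega) (fin_two_cases s)
  simp only [nodeValue, if_neg hx]
  refine ⟨by omega, ?_⟩
  rintro rfl
  have h2 := legValue_add_ge (m := m) (h := h) (k := k) (l := t + 2) (by omega)
    (by omega) (by omega) (by omega) (by omega) (fin_two_cases s) (by omega)
  push_cast
  omega

theorem nodeValue_late_leaf {s : Fin 2} {k : Fin m} {t : Fin (h - 1)}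
    (hx : z = 2 ∧ s.val = 0 ∧ k.val = 0 ∧ t.val + 2 = h) :
    nodeValue (z := z) (.inr (.inr (s, k, t)) : LegNode z m h) = legTotal z m h + 5 * h - 4 := by
  simp only [nodeValue, if_pos hx]

theorem separated_leg_late_leaf (hm : 2 ≤ m) (hh : 2 ≤ h) {s s' : Fin 2} {k k' : Fin m}
    {t t' : Fin (h - 1)} (hx : ¬(z = 2 ∧ s.val = 0 ∧ k.val = 0 ∧ t.val + 2 = h))
    (hy : z = 2 ∧ s'.val = 0 ∧ k'.val = 0 ∧ t'.val + 2 = h) :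
    Separated (z := z) (.inr (.inr (s, k, t))) (.inr (.inr (s', k', t'))) := by
  apply separated_of_le
  have h1 := nodeValue_leg_le (Or.inr hy.1) hm hh hx
  have h2 := nodeValue_late_leaf hy
  have h3 := le_nodeDist (by omega) (.inr (.inr (s, k, t)) : LegNode z m h)
    (.inr (.inr (s', k', t')))
  simp only [side, level, meet] at h3
  rw [h2]
  by_cases hs : s.val = s'.val
  · have := h1.2
    omega
  · omega

theorem separated_leg_stem (hz : z = 1 ∨ z = 2) (hm : 2 ≤ m) (hh : 2 ≤ h) (s s' : Fin 2)
    (k : Fin m) (t : Fin (h - 1)) :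
    Separated (z := z) (.inr (.inr (s, k, t))) (.inr (.inl s')) := by
  have h3 := le_nodeDist (by omega) (.inr (.inr (s, k, t)) : LegNode z m h) (.inr (.inl s'))
  have h4 : nodeValue (.inr (.inl s') : LegNode z m h) =
    2 * h + 4 - 3 * z + legTotal z m h - 1 + s' * (2 * h - 1) := rfl
  simp only [side, level, meet] at h3
  have hs' : s'.val = 0 ∨ s'.val = 1 := by omega
  by_cases hx : z = 2 ∧ s.val = 0 ∧ k.val = 0 ∧ t.val + 2 = h
  · have h2 := nodeValue_late_leaf hx
    refine (separated_of_le ?_).symm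
    rw [nodeDist_comm, h2, h4]
    rcases hs' with hs' | hs' <;> rw [hs'] at h3 ⊢ <;> push_cast at h3 ⊢ <;> omega
  · have h1 := nodeValue_leg_le hz hm hh hx
    apply separated_of_le
    rw [h4]
    rcases hs' with hs' | hs' <;> rw [hs'] at h3 ⊢ <;> push_cast at h3 ⊢ <;> omega

theorem separated_root_leg (hz : z = 1 ∨ z = 2) (hm : 2 ≤ m) (hh : 2 ≤ h) (i : Fin z)
    (s : Fin 2) (k : Fin m) (t : Fin (h - 1)) :
    Separated (z := z) (.inl i) (.inr (.inr (s, k, t))) := by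
  have h3 := le_nodeDist (by omega) (.inl i : LegNode z m h) (.inr (.inr (s, k, t)))
  have h4 : nodeValue (.inl i : LegNode z m h) = i * (legTotal z m h + 6 * h - 3) := rfl
  have h5 := legTotal_ge (z := z) hm hh
  simp only [side, level, meet] at h3
  rcases (by omega : i.val = 0 ∨ i.val = 1 ∧ z = 2) with hi | hi
  · apply separated_of_le
    rw [h4, hi]
    rw [hi] at h3
    by_cases hx : z = 2 ∧ s.val = 0 ∧ k.val = 0 ∧ t.val + 2 = h
    · rw [nodeValue_late_leaf hx]
      push_cast at *
      omega
    · have h1 := nodeValue_leg_ge hz hm hh hx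
      push_cast at *
      omega
  · refine (separated_of_le ?_).symm
    rw [nodeDist_comm, h4, hi.1]
    rw [hi.1] at h3
    by_cases hx : z = 2 ∧ s.val = 0 ∧ k.val = 0 ∧ t.val + 2 = h
    · rw [nodeValue_late_leaf hx]
      push_cast at *
      omega
    · have h1 := nodeValue_leg_le hz hm hh hx
      push_cast at *
      omega

theorem separated_root_stem (hz : z = 1 ∨ z = 2) (hm : 2 ≤ m) (hh : 2 ≤ h) (i : Fin z)
    (s : Fin 2) : Separated (z := z) (m := m) (h := h) (.inl i) (.inr (.inl s)) := by
  have h3 := le_nodeDist (by omega) (.inl i : LegNode z m h) (.inr (.inl s))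
  have h4 : nodeValue (.inl i : LegNode z m h) = i * (legTotal z m h + 6 * h - 3) := rfl
  have h6 : nodeValue (.inr (.inl s) : LegNode z m h) =
    2 * h + 4 - 3 * z + legTotal z m h - 1 + s * (2 * h - 1) := rfl
  have h5 := legTotal_ge (z := z) hm hh
  have hs : s.val = 0 ∨ s.val = 1 := by omega
  simp only [side, level, meet] at h3
  rcases (by omega : i.val = 0 ∨ i.val = 1 ∧ z = 2) with hi | hi
  · apply separated_of_le
    rw [h4, h6, hi]
    rw [hi] at h3
    rcases hs with hs | hs <;> rw [hs] at h3 ⊢ <;> push_cast at h3 ⊢ <;> omega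
  · refine (separated_of_le ?_).symm
    rw [nodeDist_comm, h4, h6, hi.1]
    rw [hi.1] at h3
    rcases hs with hs | hs <;> rw [hs] at h3 ⊢ <;> push_cast [true_imp_iff] at h3 ⊢ <;> omega

theorem separated_of_ne (hz : z = 1 ∨ z = 2) (hm : 2 ≤ m) (hh : 2 ≤ h) {x y : LegNode z m h}
    (hxy : x ≠ y) : Separated x y := by
  rcases x with i | s | ⟨s, k, t⟩ <;> rcases y with i' | s' | ⟨s', k', t'⟩
  · have hi : i.val ≠ i'.val := fun h0 => hxy (by rw [Fin.ext h0])
    have key : ∀ i i' : Fin z, i.val = 0 → i'.val = 1 →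
        Separated (z := z) (m := m) (h := h) (.inl i) (.inl i') := by
      intro i i' h1 h2
      have h3 := le_nodeDist (by omega) (.inl i : LegNode z m h) (.inl i')
      have h5 := legTotal_ge (z := z) hm hh
      apply separated_of_le
      simp only [side, level, meet, nodeValue, h1, h2] at h3 ⊢
      push_cast at *
      omega
    rcases (by omega : i.val = 0 ∧ i'.val = 1 ∨ i'.val = 0 ∧ i.val = 1) with h0 | h0
    · exact key i i' h0.1 h0.2
    · exact (key i' i h0.1 h0.2).symm
  · exact separated_root_stem hz hm hh i s'
  · exact separated_root_leg hz hm hh i s' k' t'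
  · exact (separated_root_stem hz hm hh i' s).symm
  · have hi : s.val ≠ s'.val := fun h0 => hxy (by rw [Fin.ext h0])
    have key : ∀ i i' : Fin 2, i.val = 0 → i'.val = 1 →
        Separated (z := z) (m := m) (h := h) (.inr (.inl i)) (.inr (.inl i')) := by
      intro i i' h1 h2
      have h3 := le_nodeDist (by omega) (.inr (.inl i) : LegNode z m h) (.inr (.inl i'))
      apply separated_of_le
      simp only [side, level, meet, nodeValue, h1, h2] at h3 ⊢
      push_cast at *
      omega
    rcases (by omega : s.val = 0 ∧ s'.val = 1 ∨ s'.val = 0 ∧ s.val = 1) with h0 | h0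
    · exact key s s' h0.1 h0.2
    · exact (key s' s h0.1 h0.2).symm
  · exact (separated_leg_stem hz hm hh s' s k' t').symm
  · exact (separated_root_leg hz hm hh i' s k t).symm
  · exact separated_leg_stem hz hm hh s s' k t
  · have hne : ¬(s = s' ∧ k = k' ∧ t = t') := by
      rintro ⟨rfl, rfl, rfl⟩
      exact hxy rfl
    by_cases hx : z = 2 ∧ s.val = 0 ∧ k.val = 0 ∧ t.val + 2 = h <;>
      by_cases hy : z = 2 ∧ s'.val = 0 ∧ k'.val = 0 ∧ t'.val + 2 = h
    · exact absurd ⟨Fin.ext (by omega), Fin.ext (by omega), Fin.ext (by omega)⟩ hne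
    · exact (separated_leg_late_leaf hm hh hy hx).symm
    · exact separated_leg_late_leaf hm hh hx hy
    · exact separated_leg_leg hz hm hh hne hx hy

theorem nodeValue_bounds (hz : z = 1 ∨ z = 2) (hm : 2 ≤ m) (hh : 2 ≤ h) (x : LegNode z m h) :
    0 ≤ nodeValue x ∧ nodeValue x ≤ legTotal z m h + 2 * (z + 1) * h + 1 - 2 * z := by
  have h5 := legTotal_ge (z := z) hm hh
  rcases x with i | s | ⟨s, k, t⟩
  · simp only [nodeValue]
    rcases hz with rfl | rfl
    · simp only [Fin.val_eq_zero]
      push_cast at *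
      omega
    · rcases (by omega : i.val = 0 ∨ i.val = 1) with hi | hi <;> rw [hi] <;>
        push_cast at * <;> omega
  · simp only [nodeValue]
    rcases (by omega : s.val = 0 ∨ s.val = 1) with hs | hs <;> rw [hs] <;>
      rcases hz with rfl | rfl <;> push_cast at * <;> omega
  · by_cases hx : z = 2 ∧ s.val = 0 ∧ k.val = 0 ∧ t.val + 2 = h
    · rw [nodeValue_late_leaf hx, hx.1]
      rw [hx.1] at h5
      push_cast at *
      omega
    · have h1 := nodeValue_leg_le hz hm hh hx
      have h2 := nodeValue_leg_ge hz hm hh hx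
      rcases hz with rfl | rfl <;> push_cast at * <;> omega

theorem exists_nodeValue_eq (hz : z = 1 ∨ z = 2) :
    (∃ x : LegNode z m h, nodeValue x = 0) ∧
      ∃ x : LegNode z m h, nodeValue x = legTotal z m h + 2 * (z + 1) * h + 1 - 2 * z := by
  rcases hz with rfl | rfl
  · refine ⟨⟨.inl 0, ?_⟩, .inr (.inl 1), ?_⟩
    · simp [nodeValue]
    · simp [nodeValue]
      ring
  · refine ⟨⟨.inl 0, ?_⟩, .inl 1, ?_⟩
    · simp [nodeValue]
    · simp [nodeValue]
      ring

theorem radioNumber_legTree (hz : z = 1 ∨ z = 2) (hm : 2 ≤ m) (hh : 2 ≤ h) :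
    (radioNumber (legTree z m h) : ℤ) =
      2 * m * h * (h - 2) + (z + 2) * m + 2 * (z + 1) * h + 1 - 2 * z := by
  have htot : legTotal z m h + 2 * (z + 1) * h + 1 - 2 * z =
      (2 * m * h * (h - 2) + (z + 2) * m + 2 * (z + 1) * h + 1 - 2 * z : ℤ) := by
    unfold legTotal
    ring
  obtain ⟨⟨x0, h0⟩, x1, h1⟩ := exists_nodeValue_eq (m := m) (h := h) hz
  have hb := nodeValue_bounds hz hm hh
  have hcast : ∀ x : LegNode z m h, ((nodeValue x).toNat : ℤ) = nodeValue x :=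
    fun x => Int.toNat_of_nonneg (hb x).1
  rw [← htot, ← h1, ← hcast, Nat.cast_inj]
  apply radioNumber_legTree_eq (by omega) hh hz
  · intro f hf
    rw [hcast, h1, htot]
    exact hf.exists_sub_ge hz hh
  · refine ⟨fun x => (nodeValue x).toNat, fun x y hxy => ?_, fun x => ?_, ⟨x0, by simp [h0]⟩,
      x1, rfl⟩
    · rw [hcast, hcast]
      exact separated_of_ne hz hm hh hxy
    · apply Int.toNat_le_toNat
      rw [h1]
      exact (hb x).2

end LegNode

theorem theorem4p3 (m h : ℕ) (hm : 2 ≤ m) (hh : 2 ≤ h) :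
    (radioNumber (legTree 1 m h) : ℤ)
        = 2 * (m : ℤ) * (h : ℤ) * ((h : ℤ) - 2) + 3 * (m : ℤ) + 4 * (h : ℤ) - 1 ∧
    (radioNumber (legTree 2 m h) : ℤ)
        = 2 * (m : ℤ) * (h : ℤ) * ((h : ℤ) - 2) + 4 * (m : ℤ) + 6 * (h : ℤ) - 3 := by
  rw [LegNode.radioNumber_legTree (Or.inl rfl) hm hh,
    LegNode.radioNumber_legTree (Or.inr rfl) hm hh]
  push_cast
  constructor <;> ring
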